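/- **Model.** Let $V$ be a finite vertex set. A (nonadaptive) sampling algorithm draws, from its internal randomness and independently of the input, a random set $S$ of pairs of vertices of $V$. For an input graph $G=(V,E)$ it receives $E\cap S$ and returns a real number computed from $E\cap S$ and its internal randomness. Its expected number of samples on $G$ is $\mathbb{E}|E\cap S|$. **Notation.** Let $A$ be a fixed graph on $s$ vertices. For a graph $G$ let $m$ be its number of edges, and let $M$ be the number of copies of $A$ in $G$, i.e. of (not necessarily induced) subgraphs of $G$ isomorphic to $A$. When $M\ge 1$, let $f_\ell$ be the fraction of the $M^2$ ordered pairs $(a,b)$ of copies of $A$ in $G$ ($a=b$ allowed) with $|V(a)\cap V(b)|=\ell$. **Theorem (Subgraph estimation).** For every $s$ and every $K\ge 1$ there is a constant $C>0$, depending only on $s$ and $K$, such that the following holds for every graph $A$ on $s$ vertices, every finite set $V$, every $\varepsilon>0$ and every $0<\delta<1$. Given real numbers $\widetilde M$ and $\widetilde f_1,\dots,\widetilde f_s$, there is a sampling algorithm on $V$ (which may depend on all of these data, but not on the input graph) such that, for every graph $G$ on $V$ with $M\ge 2$ whose parameters agree with the given ones up to the factor $K$, that is, $M/K\le\widetilde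 M\le KM$ and $f_\ell/K\le\widetilde f_\ell\le Kf_\ell$ for $1\le\ell\le s$, the following two statements hold. 1. With probability at least $1-\delta$ the output $\overline M$ satisfies $|\overline M-M|\le\varepsilon M$. 2. The expected number of samples satisfies $$\mathbb{E}|E\cap S|\;\le\; C\, m\,\frac{\log(1/\delta)}{\varepsilon^2}\,\log M\;\sum_{\ell=2}^{s}\Bigl(f_\ell^{2/\ell}+f_\ell^{\frac1{\ell-1}}\,f_1^{\,1-\frac1{\ell-1}}\Bigr),$$ where $0^0=1$. -/

import Mathlib

open MeasureTheory

universe u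

namespace SubgraphSampling

/-- The copies of `A` in `G`: the (not necessarily induced) subgraphs of `G` isomorphic to `A`.
Their number is Mathlib's `G.copyCount A`, see `ncard_copies`. -/
def copies {V W : Type*} (G : SimpleGraph V) (A : SimpleGraph W) : Set G.Subgraph :=
  {a | Nonempty (A ≃g a.coe)}

theorem ncard_copies {V W : Type*} [Fintype V] (G : SimpleGraph V) (A : SimpleGraph W) :
    (copies G A).ncard = G.copyCount A := by
  classical
  rw [SimpleGraph.copyCount, ← Set.ncard_coe_finset]
  congr 1
  ext a
  simp [copies]

/-- `f_ℓ`: the fraction, among all `M ^ 2` ordered pairs of copies of `A` in `G` (a copy may be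
paired with itself), of the pairs that have exactly `ℓ` vertices in common. -/
noncomputable def pairFraction {V W : Type*} [Fintype V] (G : SimpleGraph V) (A : SimpleGraph W)
    (ℓ : ℕ) : ℝ :=
  ({p : G.Subgraph × G.Subgraph | p.1 ∈ copies G A ∧ p.2 ∈ copies G A ∧
      (p.1.verts ∩ p.2.verts).ncard = ℓ}.ncard : ℝ) / (G.copyCount A : ℝ) ^ 2

/-- A nonadaptive sampling algorithm for graphs on the vertex set `V`. From its internal randomness
`r`, distributed according to `μ`, it draws a set `sample r` of vertex pairs without looking at the
input graph. It is then shown the edges of the input graph that lie in `sample r`, and computes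
its output from these edges and `r`. -/
structure SamplingAlgorithm (V : Type u) where
  Ω : Type u
  [measurableSpace : MeasurableSpace Ω]
  μ : Measure Ω
  [isProbabilityMeasure : IsProbabilityMeasure μ]
  sample : Ω → Set (Sym2 V)
  measurableSet_sample : ∀ e : Sym2 V, MeasurableSet {r | e ∈ sample r}
  output : Ω → Set (Sym2 V) → ℝ
  measurable_output : ∀ F : Set (Sym2 V), Measurable fun r => output r F

namespace SamplingAlgorithm

attribute [instance] measurableSpace isProbabilityMeasure

variable {V : Type u}

/-- The output on the input graph `G` when the internal randomness is `r`: the algorithm only sees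
the edges of `G` that it sampled. -/
def estimate (alg : SamplingAlgorithm V) (G : SimpleGraph V) (r : alg.Ω) : ℝ :=
  alg.output r (G.edgeSet ∩ alg.sample r)

/-- The expected number of edges of `G` that are sampled. -/
noncomputable def expectedSamples (alg : SamplingAlgorithm V) (G : SimpleGraph V) : ℝ :=
  ∫ r, ((G.edgeSet ∩ alg.sample r).ncard : ℝ) ∂alg.μ

/-- The probability that the output on `G` is within `ε * t` of `t`. -/
noncomputable def successProb (alg : SamplingAlgorithm V) (G : SimpleGraph V) (ε t : ℝ) : ℝ :=
  alg.μ.real {r | |alg.estimate G r - t| ≤ ε * t}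

end SamplingAlgorithm

/-- `y` agrees with `x` up to the constant factor `K`. -/
def WithinFactor (K y x : ℝ) : Prop :=
  x / K ≤ y ∧ y ≤ K * x

/-- The sum over `2 ≤ ℓ ≤ s` of `f_ℓ ^ (2 / ℓ) + f_ℓ ^ (1 / (ℓ - 1)) * f_1 ^ (1 - 1 / (ℓ - 1))`,
with real exponents and `0 ^ 0 = 1`. -/
noncomputable def rateSum (s : ℕ) (f : ℕ → ℝ) : ℝ :=
  ∑ ℓ ∈ Finset.Icc 2 s,
    (f ℓ ^ ((2 : ℝ) / (ℓ : ℝ)) +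
      f ℓ ^ ((1 : ℝ) / ((ℓ : ℝ) - 1)) * f 1 ^ (1 - (1 : ℝ) / ((ℓ : ℝ) - 1)))

end SubgraphSampling

/-!
Every vertex independently becomes active with probability `q` and receives one of `N` colours
uniformly at random. A pair of vertices is sampled if both are active and have the same colour, which
happens with probability `q ^ 2 / N`. A copy of `A` whose vertices are all active and of one colour is
called monochromatic; all its edges are sampled, so that the monochromatic copies can be counted from
the samples, and dividing their number by the probability `N * (q / N) ^ s` that a given copy is
monochromatic gives an unbiased estimate of the number `M` of copies. It does not matter whether `A`
is connected or has isolated vertices, because the colouring is known to the algorithm.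

Two disjoint copies are monochromatic independently of each other, and two copies with `ℓ ≥ 1` common
vertices are both monochromatic with `N ^ (ℓ - 1) / q ^ ℓ` times the probability of independent events
(`real_isMonochromatic_and_div_sub_one_le`). Hence the estimate has variance at most
`M ^ 2 * ∑ ℓ, f_ℓ * (N ^ (ℓ - 1) / q ^ ℓ - 1)`, and by Chebyshev's inequality it is accurate with
probability `15 / 16` if this is at most `ε ^ 2 * M ^ 2 / 16` (`le_successProb_colorAlgorithm`).

Let `x_ℓ` be `f_ℓ / ε ^ 2` up to a constant factor. The condition is met if
`x_ℓ * N ^ (ℓ - 1) ≤ q ^ ℓ` for `ℓ ≥ 2`, and `x_1 ≤ q` or `q = 1`. With the least possible `q`, and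
with `N` as large as possible if that `q` is dictated by `x_1` and `N = 1` otherwise, the rate
`q ^ 2 / N` is at most twice the sum of the terms `x_ℓ ^ (2 / ℓ)` and
`x_ℓ ^ (1 / (ℓ - 1)) * x_1 ^ (1 - 1 / (ℓ - 1))` (`exists_parameters`). These terms are homogeneous of
degree at most one, so that for `ε < 1` all of them together cost a factor `1 / ε ^ 2`
(`rateSum_le_mul_rateSum`). For `ε ≥ 1` the output `0` is good enough.

The failure probability is brought from `1 / 16` to `δ` at the price of a factor of order
`log (1 / δ)` (`SamplingAlgorithm.exists_amplification`). This needs the median of several runs if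
`δ < 1 / 2`. If `δ` is close to one, `log (1 / δ)` is close to zero, and a single run is made with
probability `2 * (1 - δ)` only. The factor `log M ≥ log 2` of the bound is not needed.
-/

namespace SubgraphSampling

/-! ### Discrete probability -/

theorem exists_probabilityMeasure_real_singleton {α : Type*} [Fintype α] [MeasurableSpace α]
    [MeasurableSingletonClass α] (w : α → ℝ) (hw : ∀ a, 0 ≤ w a) (hsum : ∑ a, w a = 1) :
    ∃ ν : Measure α, IsProbabilityMeasure ν ∧ ∀ a, ν.real {a} = w a := by
  have h1 : ∑ a, ENNReal.ofReal (w a) = 1 := by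
    rw [← ENNReal.ofReal_sum_of_nonneg fun a _ => hw a, hsum, ENNReal.ofReal_one]
  refine ⟨(PMF.ofFintype _ h1).toMeasure, inferInstance, fun a => ?_⟩
  rw [measureReal_def, PMF.toMeasure_apply_singleton _ _ (measurableSet_singleton a),
    PMF.ofFintype_apply, ENNReal.toReal_ofReal (hw a)]

theorem pi_real_forall_mem {ι α : Type*} [Fintype ι] [MeasurableSpace α] (ν : Measure α)
    [IsProbabilityMeasure ν] (J : Finset ι) (B : ι → Set α) :
    (Measure.pi fun _ : ι => ν).real {r | ∀ i ∈ J, r i ∈ B i} = ∏ i ∈ J, ν.real (B i) := by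
  have h : {r : ι → α | ∀ i ∈ J, r i ∈ B i} = (J : Set ι).pi B := by
    ext r; simp [Set.mem_pi]
  rw [h, measureReal_def, Measure.pi_pi_finset, ENNReal.toReal_prod]
  rfl

/-! ### Medians -/

theorem exists_median {ι : Type*} [Fintype ι] [Nonempty ι] (v : ι → ℝ) :
    ∃ y, Fintype.card ι ≤ 2 * (Finset.univ.filter fun i => v i ≤ y).card ∧
      Fintype.card ι ≤ 2 * (Finset.univ.filter fun i => y ≤ v i).card := by
  classical
  -- The least value that is at least as large as half of the values is a median.
  let Y := Finset.univ.filter fun i =>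
    Fintype.card ι ≤ 2 * (Finset.univ.filter fun j => v j ≤ v i).card
  have hY : Y.Nonempty := by
    obtain ⟨i, -, hi⟩ := Finset.exists_max_image Finset.univ v Finset.univ_nonempty
    refine ⟨i, ?_⟩
    have h : (Finset.univ.filter fun j => v j ≤ v i) = Finset.univ := by
      ext j; simpa using hi j (Finset.mem_univ j)
    simp only [Y, Finset.mem_filter, Finset.mem_univ, true_and, h, Finset.card_univ]
    omega
  obtain ⟨i, hiY, hi⟩ := Finset.exists_min_image Y v hY
  refine ⟨v i, (Finset.mem_filter.1 hiY).2, ?_⟩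
  have hsplit := Finset.card_filter_add_card_filter_not (s := (Finset.univ : Finset ι))
    (fun j => v i ≤ v j)
  simp only [not_le, Finset.card_univ] at hsplit
  by_contra hlt
  have hpos : (Finset.univ.filter fun j => v j < v i).Nonempty := by
    rw [← Finset.card_pos]; omega
  obtain ⟨j, hj, hjmax⟩ := Finset.exists_max_image _ v hpos
  have hj' : v j < v i := (Finset.mem_filter.1 hj).2
  have hsub : (Finset.univ.filter fun k => v k < v i) ⊆
      Finset.univ.filter fun k => v k ≤ v j := fun k hk => by
    simpa using hjmax k hk
  have hcard := Finset.card_le_card hsub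
  have hjY : j ∈ Y := by
    simp only [Y, Finset.mem_filter, Finset.mem_univ, true_and]
    omega
  exact absurd (hi j hjY) (not_le.2 hj')

/-- A median of finitely many real numbers. -/
noncomputable def median {ι : Type*} [Fintype ι] [Nonempty ι] (v : ι → ℝ) : ℝ :=
  (exists_median v).choose

/-- If the median is off, then so are at least half of the values. -/
theorem card_le_two_mul_card_of_not_abs_median_sub_le {ι : Type*} [Fintype ι] [Nonempty ι]
    (v : ι → ℝ) (t c : ℝ) (h : ¬ |median v - t| ≤ c) :
    Fintype.card ι ≤ 2 * (Finset.univ.filter fun i => ¬ |v i - t| ≤ c).card := by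
  obtain ⟨h1, h2⟩ := (exists_median v).choose_spec
  change _ ≤ 2 * (Finset.univ.filter fun i => v i ≤ median v).card at h1
  change _ ≤ 2 * (Finset.univ.filter fun i => median v ≤ v i).card at h2
  rw [abs_le, not_and_or, not_le, not_le] at h
  rcases h with h | h
  · refine h1.trans (Nat.mul_le_mul_left 2 (Finset.card_le_card fun i hi => ?_))
    simp only [Finset.mem_filter, Finset.mem_univ, true_and] at hi ⊢
    rw [abs_le, not_and_or, not_le]
    left; linarith
  · refine h2.trans (Nat.mul_le_mul_left 2 (Finset.card_le_card fun i hi => ?_))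
    simp only [Finset.mem_filter, Finset.mem_univ, true_and] at hi ⊢
    rw [abs_le, not_and_or, not_le, not_le]
    right; linarith

/-! ### Operations on sampling algorithms -/

namespace SamplingAlgorithm

variable {V : Type u}

theorem expectedSamples_le [Finite V] (alg : SamplingAlgorithm V) {P : ℝ}
    (hP : ∀ u v : V, u ≠ v → alg.μ.real {r | s(u, v) ∈ alg.sample r} ≤ P) (G : SimpleGraph V) :
    alg.expectedSamples G ≤ G.edgeSet.ncard * P := by
  classical
  have hfin : G.edgeSet.Finite := Set.toFinite _
  have hcount : ∀ r, ((G.edgeSet ∩ alg.sample r).ncard : ℝ) =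
      ∑ e ∈ hfin.toFinset, {r | e ∈ alg.sample r}.indicator 1 r := fun r => by
    have h : G.edgeSet ∩ alg.sample r =
        ((hfin.toFinset.filter fun e => e ∈ alg.sample r : Finset (Sym2 V)) : Set (Sym2 V)) := by
      ext e; simp
    rw [h, Set.ncard_coe_finset, Finset.card_filter]
    push_cast
    exact Finset.sum_congr rfl fun e _ => by simp [Set.indicator_apply]
  rw [expectedSamples]
  simp_rw [hcount]
  have hint : ∀ e ∈ hfin.toFinset,
      Integrable ({r | e ∈ alg.sample r}.indicator (1 : alg.Ω → ℝ)) alg.μ := fun e _ =>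
    (integrable_const (1 : ℝ)).indicator (alg.measurableSet_sample e)
  rw [integral_finsetSum _ hint]
  simp_rw [integral_indicator_one (alg.measurableSet_sample _)]
  rw [Set.ncard_eq_toFinset_card _ hfin, ← nsmul_eq_mul]
  refine Finset.sum_le_card_nsmul _ _ _ fun e he => ?_
  induction e with
  | h u v => exact hP u v (G.ne_of_adj (by simpa using he))

/-- The algorithm that samples nothing and always returns `c`. -/
noncomputable def const (V : Type u) (c : ℝ) : SamplingAlgorithm V where
  Ω := PUnit
  μ := Measure.dirac PUnit.unit
  sample _ := ∅
  measurableSet_sample _ := by simp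
  output _ _ := c
  measurable_output _ := measurable_const

theorem expectedSamples_const (c : ℝ) (G : SimpleGraph V) :
    (const V c).expectedSamples G = 0 := by
  have : ∀ r, G.edgeSet ∩ (const V c).sample r = ∅ := fun _ => Set.inter_empty _
  simp [expectedSamples, this]

theorem successProb_const {c ε t : ℝ} (h : |c - t| ≤ ε * t) (G : SimpleGraph V) :
    (const V c).successProb G ε t = 1 := by
  have : {r | |(const V c).estimate G r - t| ≤ ε * t} = Set.univ :=
    Set.eq_univ_of_forall fun _ => h
  rw [successProb, this, probReal_univ]

/-- `k + 1` independent runs of `alg`, on the union of the sampled sets. The output is the median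
of the outputs of the runs. -/
noncomputable def medianOfRuns (alg : SamplingAlgorithm V) [Finite alg.Ω]
    [DiscreteMeasurableSpace alg.Ω] (k : ℕ) : SamplingAlgorithm V where
  Ω := Fin (k + 1) → alg.Ω
  μ := Measure.pi fun _ => alg.μ
  sample r := ⋃ i, alg.sample (r i)
  measurableSet_sample _ := MeasurableSet.of_discrete
  output r F := median fun i => alg.output (r i) (F ∩ alg.sample (r i))
  measurable_output _ := Measurable.of_discrete

section medianOfRuns

variable (alg : SamplingAlgorithm V) [Finite alg.Ω] [DiscreteMeasurableSpace alg.Ω] (k : ℕ)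

theorem estimate_medianOfRuns (G : SimpleGraph V) (r : (alg.medianOfRuns k).Ω) :
    (alg.medianOfRuns k).estimate G r = median fun i => alg.estimate G (r i) := by
  simp only [estimate, medianOfRuns]
  congr 1
  ext i
  congr 1
  rw [Set.inter_assoc, Set.inter_eq_self_of_subset_right
    (Set.subset_iUnion (fun i => alg.sample (r i)) i)]

theorem real_mem_sample_medianOfRuns_le (e : Sym2 V) :
    (alg.medianOfRuns k).μ.real {r | e ∈ (alg.medianOfRuns k).sample r} ≤
      (k + 1) * alg.μ.real {r | e ∈ alg.sample r} := by
  have h : {r | e ∈ (alg.medianOfRuns k).sample r} =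
      ⋃ i : Fin (k + 1), {r : Fin (k + 1) → alg.Ω | ∀ j ∈ ({i} : Finset (Fin (k + 1))),
        r j ∈ {r | e ∈ alg.sample r}} := by
    simp only [medianOfRuns, Finset.mem_singleton, forall_eq]
    ext (r : Fin (k + 1) → alg.Ω)
    simp
  rw [h]
  refine (measureReal_iUnion_fintype_le _).trans (le_of_eq ?_)
  change ∑ i : Fin (k + 1), (Measure.pi fun _ : Fin (k + 1) => alg.μ).real _ = _
  simp_rw [pi_real_forall_mem alg.μ _ fun _ => {r | e ∈ alg.sample r}]
  simp

/-- If the median of the runs is off, then so are at least half of the runs, and a union bound over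
the sets of runs that may be off gives the exponential decay. -/
theorem one_sub_two_pow_le_successProb_medianOfRuns (G : SimpleGraph V) (ε t : ℝ)
    (h : 1 - 1 / 16 ≤ alg.successProb G ε t) :
    1 - (1 / 2) ^ (k + 1) ≤ (alg.medianOfRuns k).successProb G ε t := by
  classical
  set B : Set alg.Ω := {r | ¬ |alg.estimate G r - t| ≤ ε * t} with hB
  have hBle : alg.μ.real B ≤ 1 / 16 := by
    have := probReal_compl_eq_one_sub (μ := alg.μ)
      (s := {r | |alg.estimate G r - t| ≤ ε * t}) MeasurableSet.of_discrete
    rw [successProb] at h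
    have hBc : B = {r | |alg.estimate G r - t| ≤ ε * t}ᶜ := rfl
    rw [hBc]; linarith
  let π : Measure (Fin (k + 1) → alg.Ω) := Measure.pi fun _ => alg.μ
  let S : Set (Fin (k + 1) → alg.Ω) :=
    {r | |(alg.medianOfRuns k).estimate G r - t| ≤ ε * t}
  have hsub : Sᶜ ⊆ ⋃ J ∈ (Finset.univ.filter fun J : Finset (Fin (k + 1)) => k + 1 ≤ 2 * J.card),
      {r : Fin (k + 1) → alg.Ω | ∀ i ∈ J, r i ∈ B} := fun r hr => by
    replace hr : ¬ |median (fun i => alg.estimate G (r i)) - t| ≤ ε * t := by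
      have h := estimate_medianOfRuns alg k G r
      exact fun h' => hr ((congrArg (fun x => |x - t| ≤ ε * t) h).mpr h')
    have := card_le_two_mul_card_of_not_abs_median_sub_le _ _ _ hr
    rw [Fintype.card_fin] at this
    simp only [Set.mem_iUnion]
    refine ⟨_, Finset.mem_filter.2 ⟨Finset.mem_univ _, this⟩, ?_⟩
    intro i hi
    exact (Finset.mem_filter.1 hi).2
  have hJ : ∀ J ∈ (Finset.univ.filter fun J : Finset (Fin (k + 1)) => k + 1 ≤ 2 * J.card),
      π.real {r : Fin (k + 1) → alg.Ω | ∀ i ∈ J, r i ∈ B} ≤ (1 / 4) ^ (k + 1) := fun J hJ => by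
    rw [pi_real_forall_mem alg.μ J fun _ => B, Finset.prod_const]
    calc alg.μ.real B ^ J.card ≤ (1 / 16) ^ J.card :=
          pow_le_pow_left₀ measureReal_nonneg hBle _
      _ = (1 / 4) ^ (2 * J.card) := by rw [pow_mul]; norm_num
      _ ≤ (1 / 4) ^ (k + 1) :=
          pow_le_pow_of_le_one (by norm_num) (by norm_num) (Finset.mem_filter.1 hJ).2
  have hcard : (Finset.univ.filter fun J : Finset (Fin (k + 1)) => k + 1 ≤ 2 * J.card).card ≤
      2 ^ (k + 1) := by
    refine (Finset.card_le_univ _).trans (le_of_eq ?_)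
    simp
  have hfail : π.real Sᶜ ≤ (1 / 2) ^ (k + 1) :=
    calc π.real Sᶜ ≤ _ := measureReal_mono hsub (measure_ne_top π _)
      _ ≤ _ := measureReal_biUnion_finset_le _ _
      _ ≤ _ := Finset.sum_le_card_nsmul _ _ _ hJ
      _ ≤ 2 ^ (k + 1) * (1 / 4) ^ (k + 1) := by
          rw [nsmul_eq_mul]
          gcongr
          exact_mod_cast hcard
      _ = (1 / 2) ^ (k + 1) := by rw [← mul_pow]; norm_num
  have hcompl := probReal_compl_eq_one_sub (μ := π) (s := S) MeasurableSet.of_discrete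
  change _ ≤ π.real S
  linarith

end medianOfRuns

/-- Samples like `alg` with probability `ρ {true}`, decided by a coin of law `ρ`, and nothing
otherwise. -/
noncomputable def thin (alg : SamplingAlgorithm V) [Finite alg.Ω] [DiscreteMeasurableSpace alg.Ω]
    (ρ : Measure Bool) [IsProbabilityMeasure ρ] : SamplingAlgorithm V where
  Ω := Bool × alg.Ω
  μ := ρ.prod alg.μ
  sample r := {e | r.1 = true ∧ e ∈ alg.sample r.2}
  measurableSet_sample _ := MeasurableSet.of_discrete
  output r F := alg.output r.2 F
  measurable_output _ := Measurable.of_discrete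

section thin

variable (alg : SamplingAlgorithm V) [Finite alg.Ω] [DiscreteMeasurableSpace alg.Ω]
  (ρ : Measure Bool) [IsProbabilityMeasure ρ]

theorem real_mem_sample_thin (e : Sym2 V) :
    (alg.thin ρ).μ.real {r | e ∈ (alg.thin ρ).sample r} =
      ρ.real {true} * alg.μ.real {r | e ∈ alg.sample r} := by
  rw [← measureReal_prod_prod]
  congr 1

theorem mul_successProb_le_successProb_thin (G : SimpleGraph V) (ε t : ℝ) :
    ρ.real {true} * alg.successProb G ε t ≤ (alg.thin ρ).successProb G ε t := by
  rw [successProb, ← measureReal_prod_prod]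
  refine measureReal_mono (μ := ρ.prod alg.μ) ?_
  rintro ⟨b, r⟩ ⟨hb, hr⟩
  obtain rfl : b = true := hb
  simpa [estimate, thin] using hr

end thin

end SamplingAlgorithm

/-! ### Copies inside the complete graph -/

/-- A subgraph of `G`, viewed as a subgraph of the complete graph. -/
def toComplete {V : Type*} {G : SimpleGraph V} (a : G.Subgraph) :
    (⊤ : SimpleGraph V).Subgraph where
  verts := a.verts
  Adj := a.Adj
  adj_sub h := (a.adj_sub h).ne
  edge_vert := a.edge_vert
  symm := a.symm

theorem toComplete_injective {V : Type*} {G : SimpleGraph V} :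
    Function.Injective (toComplete : G.Subgraph → _) := fun a b h => by
  have hv : (toComplete a).verts = (toComplete b).verts := by rw [h]
  have ha : (toComplete a).Adj = (toComplete b).Adj := by rw [h]
  exact SimpleGraph.Subgraph.ext hv ha

/-- The copies of `A` in the complete graph all of whose edges lie in `F`. If `F` is the edge set of
`G`, they correspond to the copies of `A` in `G`, but their type does not depend on `G`. -/
def copiesWithin {V W : Type*} (A : SimpleGraph W) (F : Set (Sym2 V)) :
    Set (⊤ : SimpleGraph V).Subgraph :=
  {b | b ∈ copies ⊤ A ∧ b.edgeSet ⊆ F}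

theorem image_toComplete_copies {V W : Type*} (G : SimpleGraph V) (A : SimpleGraph W) :
    toComplete '' copies G A = copiesWithin A G.edgeSet := by
  ext b
  constructor
  · rintro ⟨a, ha, rfl⟩
    exact ⟨ha, a.edgeSet_subset⟩
  · rintro ⟨hb, hbG⟩
    have hadj : ∀ {v w}, b.Adj v w → G.Adj v w := fun h =>
      (SimpleGraph.mem_edgeSet G).1 (hbG (SimpleGraph.Subgraph.mem_edgeSet.2 h))
    exact ⟨⟨b.verts, b.Adj, hadj, b.edge_vert, b.symm⟩, hb, rfl⟩

theorem ncard_copiesWithin_edgeSet {V W : Type*} [Fintype V] (G : SimpleGraph V)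
    (A : SimpleGraph W) : (copiesWithin A G.edgeSet).ncard = G.copyCount A := by
  rw [← image_toComplete_copies, Set.ncard_image_of_injective _ toComplete_injective,
    ncard_copies]

theorem ncard_pairs_copiesWithin_edgeSet {V W : Type*} (G : SimpleGraph V) (A : SimpleGraph W)
    (ℓ : ℕ) :
    {p : (⊤ : SimpleGraph V).Subgraph × (⊤ : SimpleGraph V).Subgraph |
      p.1 ∈ copiesWithin A G.edgeSet ∧ p.2 ∈ copiesWithin A G.edgeSet ∧
        (p.1.verts ∩ p.2.verts).ncard = ℓ}.ncard =
    {p : G.Subgraph × G.Subgraph | p.1 ∈ copies G A ∧ p.2 ∈ copies G A ∧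
      (p.1.verts ∩ p.2.verts).ncard = ℓ}.ncard := by
  refine Eq.trans (congrArg Set.ncard ?_) (Set.ncard_image_of_injective _
    ((toComplete_injective (G := G)).prodMap (toComplete_injective (G := G))))
  rw [← image_toComplete_copies]
  ext ⟨b, b'⟩
  constructor
  · rintro ⟨⟨a, ha, rfl⟩, ⟨a', ha', rfl⟩, h⟩
    exact ⟨(a, a'), ⟨ha, ha', h⟩, rfl⟩
  · rintro ⟨⟨a, a'⟩, ⟨ha, ha', h⟩, he⟩
    obtain ⟨rfl, rfl⟩ := Prod.mk.inj he
    exact ⟨⟨a, ha, rfl⟩, ⟨a', ha', rfl⟩, h⟩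

theorem pairFraction_nonneg {V W : Type*} [Fintype V] (G : SimpleGraph V) (A : SimpleGraph W)
    (ℓ : ℕ) : 0 ≤ pairFraction G A ℓ := by
  unfold pairFraction; positivity

theorem ncard_verts_of_mem_copies {V : Type*} {s : ℕ} {G : SimpleGraph V}
    {A : SimpleGraph (Fin s)} {b : G.Subgraph} (hb : b ∈ copies G A) : b.verts.ncard = s := by
  obtain ⟨e⟩ := hb
  rw [← Nat.card_coe_set_eq, ← Nat.card_congr e.toEquiv, Nat.card_fin]

/-- Every copy forms a pair with itself. -/
theorem pairFraction_self_pos {V : Type*} [Fintype V] {s : ℕ} (G : SimpleGraph V)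
    (A : SimpleGraph (Fin s)) (h : 0 < G.copyCount A) : 0 < pairFraction G A s := by
  unfold pairFraction
  have h' : 0 < (copies G A).ncard := by rwa [ncard_copies]
  obtain ⟨a, ha⟩ := (Set.ncard_pos (Set.toFinite _)).1 h'
  have : 0 < {p : G.Subgraph × G.Subgraph | p.1 ∈ copies G A ∧ p.2 ∈ copies G A ∧
      (p.1.verts ∩ p.2.verts).ncard = s}.ncard := by
    rw [Set.ncard_pos (Set.toFinite _)]
    exact ⟨(a, a), ha, ha, by rw [Set.inter_self]; exact ncard_verts_of_mem_copies ha⟩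
  positivity

/-- A graph on at most one vertex has no edges, so its copies are the same in all graphs. -/
theorem copyCount_eq_copyCount_bot {V : Type*} [Fintype V] {s : ℕ} (hs : s ≤ 1)
    (G : SimpleGraph V) (A : SimpleGraph (Fin s)) : G.copyCount A =
      (⊥ : SimpleGraph V).copyCount A := by
  have hsub : Subsingleton (Fin s) := Fin.subsingleton_iff_le_one.2 hs
  have key : ∀ F : Set (Sym2 V), copiesWithin A F = copies ⊤ A := fun F => by
    refine Set.Subset.antisymm (fun b hb => hb.1) fun b hb => ⟨hb, fun e he => ?_⟩
    exfalso
    obtain ⟨φ⟩ := hb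
    induction e with
    | h v w =>
      have hvw : b.Adj v w := he
      exact hvw.ne (congrArg Subtype.val (φ.symm.injective
        (Subsingleton.elim (φ.symm ⟨v, hvw.fst_mem⟩) (φ.symm ⟨w, hvw.snd_mem⟩))))
  rw [← ncard_copiesWithin_edgeSet, ← ncard_copiesWithin_edgeSet, key, key]

/-! ### Monochromatic sampling -/

/-- All vertices in `U` are active and have the same colour, where `r v` is the colour of `v`
together with the bit that says whether `v` is active. -/
def IsMonochromatic {V : Type*} {N : ℕ} (r : V → Fin N × Bool) (U : Set V) : Prop :=
  ∃ c, ∀ v ∈ U, r v = (c, true)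

section probabilities

variable {V : Type*} [Fintype V] {N : ℕ} {ν : Measure (Fin N × Bool)} [IsProbabilityMeasure ν]
  {α : ℝ}

theorem real_isMonochromatic (hν : ∀ c, ν.real {(c, true)} = α) (U : Finset V)
    (hU : U.Nonempty) :
    (Measure.pi fun _ : V => ν).real {r | IsMonochromatic r U} = N * α ^ U.card := by
  have h : {r : V → Fin N × Bool | IsMonochromatic r U} =
      ⋃ c : Fin N, {r : V → Fin N × Bool | ∀ v ∈ U, r v ∈ ({(c, true)} : Set (Fin N × Bool))} := by
    ext r; simp [IsMonochromatic]
  rw [h, measureReal_iUnion_fintype ?_ fun _ => MeasurableSet.of_discrete]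
  · simp_rw [pi_real_forall_mem ν, hν]
    simp
  · intro c d hcd
    refine Set.disjoint_left.2 fun r hc hd => hcd ?_
    obtain ⟨v, hv⟩ := hU
    have h1 : r v = (c, true) := hc v hv
    have h2 : r v = (d, true) := hd v hv
    exact (Prod.mk.inj (h1.symm.trans h2)).1

/-- Two sets that share a vertex are monochromatic together if and only if their union is. -/
theorem real_isMonochromatic_and_of_nonempty_inter [DecidableEq V]
    (hν : ∀ c, ν.real {(c, true)} = α) (U U' : Finset V) (h : (U ∩ U').Nonempty) :
    (Measure.pi fun _ : V => ν).real {r | IsMonochromatic r U ∧ IsMonochromatic r U'} =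
      N * α ^ (U ∪ U').card := by
  obtain ⟨v, hv⟩ := h
  rw [Finset.mem_inter] at hv
  rw [← real_isMonochromatic hν (U ∪ U') ⟨v, Finset.mem_union_left _ hv.1⟩]
  congr 1
  ext r
  constructor
  · rintro ⟨⟨c, hc⟩, ⟨d, hd⟩⟩
    have hcd : c = d := (Prod.mk.inj ((hc v hv.1).symm.trans (hd v hv.2))).1
    subst hcd
    refine ⟨c, fun w hw => ?_⟩
    rcases Finset.mem_union.1 hw with hw | hw
    exacts [hc w hw, hd w hw]
  · rintro ⟨c, hc⟩
    exact ⟨⟨c, fun w hw => hc w (Finset.mem_union_left _ hw)⟩,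
      ⟨c, fun w hw => hc w (Finset.mem_union_right _ hw)⟩⟩

theorem real_isMonochromatic_and_le_of_disjoint [DecidableEq V]
    (hν : ∀ c, ν.real {(c, true)} = α) (U U' : Finset V) (h : Disjoint U U') :
    (Measure.pi fun _ : V => ν).real {r | IsMonochromatic r U ∧ IsMonochromatic r U'} ≤
      N ^ 2 * α ^ (U.card + U'.card) := by
  have hsub : {r : V → Fin N × Bool | IsMonochromatic r U ∧ IsMonochromatic r U'} ⊆
      ⋃ c : Fin N × Fin N, {r : V → Fin N × Bool | ∀ v ∈ U ∪ U',
        r v ∈ ({(if v ∈ U then c.1 else c.2, true)} : Set (Fin N × Bool))} := by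
    rintro r ⟨⟨c, hc⟩, ⟨d, hd⟩⟩
    refine Set.mem_iUnion.2 ⟨(c, d), fun v hv => ?_⟩
    rw [Set.mem_singleton_iff]
    by_cases hvU : v ∈ U
    · rw [if_pos hvU]; exact hc v hvU
    · rw [if_neg hvU]; exact hd v ((Finset.mem_union.1 hv).resolve_left hvU)
  refine (measureReal_mono hsub (measure_ne_top _ _)).trans
    ((measureReal_iUnion_fintype_le _).trans (le_of_eq ?_))
  simp_rw [pi_real_forall_mem ν (U ∪ U') fun v => {(if v ∈ U then _ else _, true)}, hν]
  simp [Finset.card_union_of_disjoint h, sq]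

end probabilities

/-- The second moment method for a rescaled count of events that all have probability `p`. -/
theorem real_le_abs_sum_indicator_div_sub_card_le {Ω ι : Type*} [MeasurableSpace Ω] [Finite Ω]
    [DiscreteMeasurableSpace Ω] (μ : Measure Ω) [IsProbabilityMeasure μ] (T : Finset ι)
    (E : ι → Set Ω) {p c : ℝ} (hp : p ≠ 0) (hE : ∀ b ∈ T, μ.real (E b) = p) (hc : 0 < c) :
    μ.real {r | c ≤ |(∑ b ∈ T, (E b).indicator 1 r) / p - (T.card : ℝ)|} ≤
      (∑ x ∈ T ×ˢ T, (μ.real (E x.1 ∩ E x.2) / p ^ 2 - 1)) / c ^ 2 := by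
  let X : Ω → ℝ := fun r => (∑ b ∈ T, (E b).indicator 1 r) / p
  have hint : ∀ f : Ω → ℝ, Integrable f μ := fun f => Integrable.of_finite
  have hmean : ∫ r, X r ∂μ = T.card := by
    simp only [X]
    rw [integral_div, integral_finsetSum _ fun b _ => hint _]
    simp_rw [integral_indicator_one MeasurableSet.of_discrete]
    rw [Finset.sum_congr rfl hE, Finset.sum_const, nsmul_eq_mul, mul_div_cancel_right₀ _ hp]
  have hsq : ∫ r, (X ^ 2) r ∂μ = ∑ x ∈ T ×ˢ T, μ.real (E x.1 ∩ E x.2) / p ^ 2 := by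
    have h : ∀ r, (X ^ 2) r = (∑ x ∈ T ×ˢ T, (E x.1 ∩ E x.2).indicator 1 r) / p ^ 2 := fun r => by
      simp only [X, Pi.pow_apply]
      rw [div_pow, sq (∑ b ∈ T, _), Finset.sum_mul_sum, Finset.sum_product]
      simp only [Set.inter_indicator_one, Pi.mul_apply]
    simp_rw [h]
    rw [integral_div, integral_finsetSum _ fun b _ => hint _, Finset.sum_div]
    simp_rw [integral_indicator_one MeasurableSet.of_discrete]
  have hX : MemLp X 2 μ := MemLp.of_discrete
  have hvar : ProbabilityTheory.variance X μ =
      ∑ x ∈ T ×ˢ T, (μ.real (E x.1 ∩ E x.2) / p ^ 2 - 1) := by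
    rw [ProbabilityTheory.variance_eq_sub hX, hsq, hmean, Finset.sum_sub_distrib,
      Finset.sum_const, Finset.card_product, nsmul_eq_mul, mul_one, Nat.cast_mul,
      sq (T.card : ℝ)]
  have hcheb := ProbabilityTheory.meas_ge_le_variance_div_sq hX hc
  rw [hmean, hvar] at hcheb
  refine ENNReal.toReal_le_of_le_ofReal ?_ hcheb
  rw [← hvar]
  exact div_nonneg (ProbabilityTheory.variance_nonneg _ _) (sq_nonneg _)

/-- The algorithm that gives every vertex an independent colour and activity bit of law `ν`, samples
the pairs that are monochromatic, and counts the monochromatic copies of `A`, rescaled by the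
probability `N * α ^ s` of being monochromatic. -/
noncomputable def colorAlgorithm (V : Type u) [Fintype V] {s : ℕ} (A : SimpleGraph (Fin s)) {N : ℕ}
    (ν : Measure (Fin N × Bool)) [IsProbabilityMeasure ν] (α : ℝ) : SamplingAlgorithm V where
  Ω := V → Fin N × Bool
  μ := Measure.pi fun _ => ν
  sample r := {e | IsMonochromatic r {v | v ∈ e}}
  measurableSet_sample _ := MeasurableSet.of_discrete
  output r F := ({b | b ∈ copiesWithin A F ∧ IsMonochromatic r b.verts}.ncard : ℝ) / (N * α ^ s)
  measurable_output _ := Measurable.of_discrete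

section colorAlgorithm

variable {V : Type u} [Fintype V] {s : ℕ} (A : SimpleGraph (Fin s)) {N : ℕ}
  (ν : Measure (Fin N × Bool)) [IsProbabilityMeasure ν] {α : ℝ}

/-- All edges of a monochromatic copy are sampled. -/
theorem estimate_colorAlgorithm (G : SimpleGraph V) (r : V → Fin N × Bool) :
    (colorAlgorithm V A ν α).estimate G r =
      (∑ b ∈ (copiesWithin A G.edgeSet).toFinite.toFinset,
        {r : V → Fin N × Bool | IsMonochromatic r b.verts}.indicator 1 r) / (N * α ^ s) := by
  classical
  have h : {b | b ∈ copiesWithin A (G.edgeSet ∩ {e | IsMonochromatic r {v | v ∈ e}}) ∧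
        IsMonochromatic r b.verts} =
      (((copiesWithin A G.edgeSet).toFinite.toFinset.filter fun b =>
        IsMonochromatic r b.verts : Finset _) : Set (⊤ : SimpleGraph V).Subgraph) := by
    ext b
    simp only [Finset.coe_filter, Set.Finite.mem_toFinset]
    constructor
    · rintro ⟨⟨hb, hF⟩, hr⟩
      exact ⟨⟨hb, hF.trans Set.inter_subset_left⟩, hr⟩
    · rintro ⟨⟨hb, hF⟩, c, hc⟩
      exact ⟨⟨hb, fun e he => ⟨hF he, c, fun v hv => hc v (b.mem_verts_of_mem_edge he hv)⟩⟩, c, hc⟩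
  change ({b | b ∈ copiesWithin A (G.edgeSet ∩ {e | IsMonochromatic r {v | v ∈ e}}) ∧
        IsMonochromatic r b.verts}.ncard : ℝ) / (N * α ^ s) = _
  rw [h, Set.ncard_coe_finset, Finset.card_filter]
  push_cast
  rfl

theorem real_mem_sample_colorAlgorithm (hν : ∀ c, ν.real {(c, true)} = α) {u v : V} (huv : u ≠ v) :
    (colorAlgorithm V A ν α).μ.real {r | s(u, v) ∈ (colorAlgorithm V A ν α).sample r} =
      N * α ^ 2 := by
  classical
  rw [← Finset.card_pair huv, ← real_isMonochromatic hν {u, v} (Finset.insert_nonempty _ _)]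
  have h : ∀ r : V → Fin N × Bool, IsMonochromatic r {w | w ∈ s(u, v)} ↔
      IsMonochromatic r (({u, v} : Finset V) : Set V) := fun r => by
    simp [IsMonochromatic]
  exact congrArg (Measure.pi fun _ : V => ν).real (Set.ext h)

/-- Compared to two independent copies, two copies with `ℓ ≥ 1` common vertices are
`N ^ (ℓ - 1) / q ^ ℓ` times as likely to be both monochromatic; two disjoint copies are not more
likely. -/
theorem real_isMonochromatic_and_div_sub_one_le {q : ℝ} (hq : 0 < q) (hN : 0 < N)
    (hν : ∀ c, ν.real {(c, true)} = q / N) (U U' : Set V) (hU : U.ncard = s) (hU' : U'.ncard = s) :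
    (Measure.pi fun _ : V => ν).real
        ({r | IsMonochromatic r U} ∩ {r | IsMonochromatic r U'}) / (N * (q / N) ^ s) ^ 2 - 1 ≤
      ∑ ℓ ∈ Finset.Icc 1 s,
        if (U ∩ U').ncard = ℓ then (N : ℝ) ^ (ℓ - 1) / q ^ ℓ - 1 else 0 := by
  classical
  have hN' : (0 : ℝ) < N := by exact_mod_cast hN
  lift U to Finset V using Set.toFinite U
  lift U' to Finset V using Set.toFinite U'
  have hinter : ((U : Set V) ∩ U').ncard = (U ∩ U').card := by
    rw [← Finset.coe_inter, Set.ncard_coe_finset]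
  rw [Set.ncard_coe_finset] at hU hU'
  have hset : {r : V → Fin N × Bool | IsMonochromatic r U} ∩ {r | IsMonochromatic r U'} =
    {r | IsMonochromatic r U ∧ IsMonochromatic r U'} := rfl
  rw [hinter, Finset.sum_ite_eq, hset]
  have hπ : 0 < (N * (q / N) ^ s : ℝ) ^ 2 := by positivity
  rcases (U ∩ U').eq_empty_or_nonempty with h | h
  · rw [h, Finset.card_empty, if_neg (by simp), sub_nonpos, div_le_one hπ]
    refine (real_isMonochromatic_and_le_of_disjoint hν U U'
      (Finset.disjoint_iff_inter_eq_empty.2 h)).trans (le_of_eq ?_)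
    rw [hU, hU', pow_add]
    ring
  · have hpos := Finset.card_pos.2 h
    have hle : (U ∩ U').card ≤ s := hU ▸ Finset.card_le_card Finset.inter_subset_left
    rw [if_pos (Finset.mem_Icc.2 ⟨hpos, hle⟩), real_isMonochromatic_and_of_nonempty_inter hν U U' h]
    have hsum := Finset.card_union_add_card_inter U U'
    rw [hU, hU'] at hsum
    obtain ⟨ℓ, hℓ⟩ : ∃ ℓ, (U ∩ U').card = ℓ + 1 := ⟨_, (Nat.succ_pred_eq_of_pos hpos).symm⟩
    rw [hℓ] at hsum ⊢
    have hα : (0 : ℝ) < q / N := by positivity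
    have h1 : (N * (q / N) ^ s : ℝ) ^ 2 =
        (N * (q / N) ^ (U ∪ U').card) * (N * (q / N) ^ (ℓ + 1)) := by
      calc (N * (q / N) ^ s : ℝ) ^ 2 = N ^ 2 * (q / N) ^ (s + s) := by rw [pow_add]; ring
        _ = _ := by rw [← hsum, pow_add]; ring
    have h2 : (N * (q / N) ^ (ℓ + 1) : ℝ) = q ^ (ℓ + 1) / N ^ ℓ := by
      rw [div_pow, pow_succ (N : ℝ)]; field_simp
    rw [h1, div_mul_eq_div_div, div_self (by positivity), h2, one_div_div]
    simp

/-- Chebyshev's inequality: the variance is `M ^ 2 * ∑ ℓ, f_ℓ * (N ^ (ℓ - 1) / q ^ ℓ - 1)` at most. -/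
theorem le_successProb_colorAlgorithm {q : ℝ} (hq : 0 < q) (hN : 0 < N) (hs : 0 < s)
    (hν : ∀ c, ν.real {(c, true)} = q / N) (G : SimpleGraph V) {ε : ℝ} (hε : 0 < ε)
    (hG : 0 < G.copyCount A)
    (h : ∑ ℓ ∈ Finset.Icc 1 s, pairFraction G A ℓ * ((N : ℝ) ^ (ℓ - 1) / q ^ ℓ - 1) ≤
      ε ^ 2 / 16) :
    1 - 1 / 16 ≤ (colorAlgorithm V A ν (q / N)).successProb G ε (G.copyCount A) := by
  classical
  have hN' : (0 : ℝ) < N := by exact_mod_cast hN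
  have hM : (0 : ℝ) < G.copyCount A := by exact_mod_cast hG
  set T := (copiesWithin A G.edgeSet).toFinite.toFinset with hT
  have hcardT : T.card = G.copyCount A := by
    rw [← ncard_copiesWithin_edgeSet, Set.ncard_eq_toFinset_card _ (Set.toFinite _)]
  have hverts : ∀ b ∈ T, b.verts.ncard = s := fun b hb =>
    ncard_verts_of_mem_copies ((Set.Finite.mem_toFinset _).1 hb).1
  let π : Measure (V → Fin N × Bool) := Measure.pi fun _ => ν
  let E : (⊤ : SimpleGraph V).Subgraph → Set (V → Fin N × Bool) :=
    fun b => {r | IsMonochromatic r b.verts}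
  have hE : ∀ b ∈ T, π.real (E b) = N * (q / N) ^ s := fun b hb => by
    have hb' := hverts b hb
    have hne : b.verts.toFinset.Nonempty := by
      rw [← Finset.card_pos, ← Set.ncard_eq_toFinset_card', hb']; exact hs
    have := real_isMonochromatic hν b.verts.toFinset hne
    rwa [Set.coe_toFinset, ← Set.ncard_eq_toFinset_card', hb'] at this
  have hfail := real_le_abs_sum_indicator_div_sub_card_le π T E (p := N * (q / N) ^ s)
    (c := ε * G.copyCount A) (by positivity) hE (by positivity)
  have hcount : ∀ ℓ, ((T ×ˢ T).filter fun x => (x.1.verts ∩ x.2.verts).ncard = ℓ).card =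
      (G.copyCount A : ℝ) ^ 2 * pairFraction G A ℓ := fun ℓ => by
    rw [pairFraction, mul_div_cancel₀ _ (by positivity), ← ncard_pairs_copiesWithin_edgeSet,
      ← Set.ncard_coe_finset]
    congr 2
    ext x
    simp [T, and_assoc]
  have hsum : ∑ x ∈ T ×ˢ T, (π.real (E x.1 ∩ E x.2) / (N * (q / N) ^ s) ^ 2 - 1) ≤
      (G.copyCount A : ℝ) ^ 2 * (ε ^ 2 / 16) := by
    calc _ ≤ ∑ x ∈ T ×ˢ T, ∑ ℓ ∈ Finset.Icc 1 s,
          if (x.1.verts ∩ x.2.verts).ncard = ℓ then (N : ℝ) ^ (ℓ - 1) / q ^ ℓ - 1 else 0 := by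
          refine Finset.sum_le_sum fun x hx => ?_
          rw [Finset.mem_product] at hx
          exact real_isMonochromatic_and_div_sub_one_le ν hq hN hν _ _
            (hverts _ hx.1) (hverts _ hx.2)
      _ = ∑ ℓ ∈ Finset.Icc 1 s, (G.copyCount A : ℝ) ^ 2 *
          (pairFraction G A ℓ * ((N : ℝ) ^ (ℓ - 1) / q ^ ℓ - 1)) := by
          rw [Finset.sum_comm]
          refine Finset.sum_congr rfl fun ℓ _ => ?_
          rw [← Finset.sum_filter, Finset.sum_const, nsmul_eq_mul, hcount, mul_assoc]
      _ ≤ _ := by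
          rw [← Finset.mul_sum]
          gcongr
  let S : Set (V → Fin N × Bool) :=
    {r | |(colorAlgorithm V A ν (q / N)).estimate G r - G.copyCount A| ≤ ε * G.copyCount A}
  have hcompl := probReal_compl_eq_one_sub (μ := π) (s := S) MeasurableSet.of_discrete
  have hle : π.real Sᶜ ≤ 1 / 16 := by
    refine (measureReal_mono (fun r hr => ?_) (measure_ne_top π _)).trans (hfail.trans ?_)
    · have hr' : ¬ |(colorAlgorithm V A ν (q / N)).estimate G r - G.copyCount A| ≤
        ε * G.copyCount A := hr
      rw [estimate_colorAlgorithm, ← hT, not_le] at hr'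
      rw [hcardT]
      exact hr'.le
    · rw [div_le_iff₀ (by positivity)]
      refine hsum.trans (le_of_eq ?_)
      ring
  change _ ≤ π.real S
  linarith

end colorAlgorithm

/-- The edges are sampled at rate `q ^ 2 / N`. -/
theorem exists_monochromatic_sampling (V : Type u) [Fintype V] {s : ℕ} (hs : 0 < s)
    (A : SimpleGraph (Fin s)) {N : ℕ} (hN : 0 < N) {q : ℝ} (hq : 0 < q) (hq1 : q ≤ 1) :
    ∃ (alg : SamplingAlgorithm V) (_ : Finite alg.Ω) (_ : DiscreteMeasurableSpace alg.Ω),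
      (∀ u v : V, u ≠ v → alg.μ.real {r | s(u, v) ∈ alg.sample r} = q ^ 2 / N) ∧
      ∀ (G : SimpleGraph V) (ε : ℝ), 0 < ε → 0 < G.copyCount A →
        ∑ ℓ ∈ Finset.Icc 1 s, pairFraction G A ℓ * ((N : ℝ) ^ (ℓ - 1) / q ^ ℓ - 1) ≤
          ε ^ 2 / 16 →
        1 - 1 / 16 ≤ alg.successProb G ε (G.copyCount A) := by
  have hN' : (0 : ℝ) < N := by exact_mod_cast hN
  obtain ⟨ν, hν1, hν⟩ := exists_probabilityMeasure_real_singleton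
    (fun x : Fin N × Bool => if x.2 then q / N else (1 - q) / N)
    (fun x => by
      have := sub_nonneg.2 hq1
      split_ifs <;> positivity)
    (by
      rw [Fintype.sum_prod_type]
      simp only [Fintype.sum_bool, Finset.sum_const, Finset.card_univ, Fintype.card_fin,
        nsmul_eq_mul, if_true, Bool.false_eq_true, if_false]
      field_simp
      ring)
  have hν' : ∀ c, ν.real {(c, true)} = q / N := fun c => by simp [hν]
  refine ⟨colorAlgorithm V A ν (q / N), ?_, ?_, fun u v huv => ?_, fun G ε hε hG h =>
    le_successProb_colorAlgorithm A ν hq hN hs hν' G hε hG h⟩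
  · exact inferInstanceAs (Finite (V → Fin N × Bool))
  · exact inferInstanceAs (DiscreteMeasurableSpace (V → Fin N × Bool))
  · rw [real_mem_sample_colorAlgorithm A ν hν' huv]
    field_simp

/-! ### Trading failure probability against samples -/

/-- For `δ < 1 / 2`, take the median of about `log (1 / δ)` runs. For `δ ≥ 1 / 2`, one run with
probability `2 * (1 - δ)` is enough. -/
theorem SamplingAlgorithm.exists_amplification {V : Type u} (alg : SamplingAlgorithm V)
    [Finite alg.Ω] [DiscreteMeasurableSpace alg.Ω] {δ : ℝ} (hδ : 0 < δ) (hδ1 : δ < 1) :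
    ∃ alg' : SamplingAlgorithm V,
      (∀ e : Sym2 V, alg'.μ.real {r | e ∈ alg'.sample r} ≤
        2 / Real.log 2 * Real.log (1 / δ) * alg.μ.real {r | e ∈ alg.sample r}) ∧
      ∀ (G : SimpleGraph V) (ε t : ℝ), 1 - 1 / 16 ≤ alg.successProb G ε t →
        1 - δ ≤ alg'.successProb G ε t := by
  have hlog2 : 0 < Real.log 2 := Real.log_pos one_lt_two
  rcases lt_or_ge δ (1 / 2) with h | h
  · set L := Real.log (1 / δ) / Real.log 2 with hL
    have hL1 : 1 ≤ L := by
      rw [hL, one_le_div hlog2]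
      refine Real.log_le_log two_pos ?_
      rw [le_div_iff₀ hδ]
      linarith
    refine ⟨alg.medianOfRuns ⌊L⌋₊, fun e => ?_, fun G ε t hG => ?_⟩
    · refine (alg.real_mem_sample_medianOfRuns_le _ e).trans ?_
      have hfloor := Nat.floor_le (zero_le_one.trans hL1)
      have heq : 2 / Real.log 2 * Real.log (1 / δ) = 2 * L := by rw [hL]; ring
      rw [heq]
      gcongr
      linarith
    · refine le_trans ?_ (alg.one_sub_two_pow_le_successProb_medianOfRuns _ G ε t hG)
      have hlt := Nat.lt_floor_add_one L
      have hpow : (1 / 2 : ℝ) ^ (⌊L⌋₊ + 1) ≤ δ := by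
        rw [← Real.log_le_log_iff (by positivity) hδ, Real.log_pow, one_div, Real.log_inv]
        have hLmul : L * Real.log 2 = -Real.log δ := by
          rw [hL, div_mul_cancel₀ _ hlog2.ne', one_div, Real.log_inv]
        have := mul_lt_mul_of_pos_right hlt hlog2
        push_cast
        linarith
      linarith
  · obtain ⟨ρ, hρ1, hρ⟩ := exists_probabilityMeasure_real_singleton
      (fun b : Bool => if b then 2 * (1 - δ) else 1 - 2 * (1 - δ))
      (fun b => by split_ifs <;> linarith) (by simp)
    have hρt : ρ.real {true} = 2 * (1 - δ) := by simp [hρ]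
    refine ⟨alg.thin ρ, fun e => ?_, fun G ε t hG => ?_⟩
    · rw [alg.real_mem_sample_thin, hρt]
      have h1 : 1 - δ ≤ Real.log (1 / δ) := by
        rw [one_div, Real.log_inv]
        linarith [Real.log_le_sub_one_of_pos hδ]
      have h2 : 2 ≤ 2 / Real.log 2 := by
        rw [le_div_iff₀ hlog2]
        linarith [Real.log_two_lt_d9]
      have : 0 ≤ 1 - δ := by linarith
      gcongr
    · refine le_trans ?_ (alg.mul_successProb_le_successProb_thin ρ G ε t)
      rw [hρt]
      nlinarith

/-! ### The choice of the parameters -/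

theorem rateSum_nonneg {s : ℕ} {f : ℕ → ℝ} (hf : ∀ ℓ ∈ Finset.Icc 1 s, 0 ≤ f ℓ) :
    0 ≤ rateSum s f := by
  refine Finset.sum_nonneg fun ℓ hℓ => ?_
  rw [Finset.mem_Icc] at hℓ
  have h1 := hf 1 (Finset.mem_Icc.2 ⟨le_rfl, by omega⟩)
  have h2 := hf ℓ (Finset.mem_Icc.2 ⟨by omega, hℓ.2⟩)
  positivity

theorem term_le_rateSum {s : ℕ} {f : ℕ → ℝ} (hf : ∀ ℓ ∈ Finset.Icc 1 s, 0 ≤ f ℓ) {ℓ : ℕ}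
    (hℓ : ℓ ∈ Finset.Icc 2 s) :
    f ℓ ^ ((2 : ℝ) / (ℓ : ℝ)) +
      f ℓ ^ ((1 : ℝ) / ((ℓ : ℝ) - 1)) * f 1 ^ (1 - (1 : ℝ) / ((ℓ : ℝ) - 1)) ≤ rateSum s f := by
  refine Finset.single_le_sum (f := fun ℓ : ℕ => f ℓ ^ ((2 : ℝ) / (ℓ : ℝ)) +
      f ℓ ^ ((1 : ℝ) / ((ℓ : ℝ) - 1)) * f 1 ^ (1 - (1 : ℝ) / ((ℓ : ℝ) - 1)))
      (fun ℓ hℓ => ?_) hℓ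
  rw [Finset.mem_Icc] at hℓ
  have h1 := hf 1 (Finset.mem_Icc.2 ⟨le_rfl, by omega⟩)
  have h2 := hf ℓ (Finset.mem_Icc.2 ⟨by omega, hℓ.2⟩)
  positivity

/-- All terms of the rate are homogeneous of degree at most one. -/
theorem rateSum_le_mul_rateSum {s : ℕ} {x f : ℕ → ℝ} {D : ℝ} (hD : 1 ≤ D)
    (hx : ∀ ℓ ∈ Finset.Icc 1 s, 0 ≤ x ℓ) (hf : ∀ ℓ ∈ Finset.Icc 1 s, 0 ≤ f ℓ)
    (h : ∀ ℓ ∈ Finset.Icc 1 s, x ℓ ≤ D * f ℓ) : rateSum s x ≤ D * rateSum s f := by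
  rw [rateSum, rateSum, Finset.mul_sum]
  refine Finset.sum_le_sum fun ℓ hℓ => ?_
  rw [Finset.mem_Icc] at hℓ
  have m1 : 1 ∈ Finset.Icc 1 s := Finset.mem_Icc.2 ⟨le_rfl, by omega⟩
  have mℓ : ℓ ∈ Finset.Icc 1 s := Finset.mem_Icc.2 ⟨by omega, hℓ.2⟩
  have hx1 := hx 1 m1
  have hxℓ := hx ℓ mℓ
  have hf1 := hf 1 m1
  have hfℓ := hf ℓ mℓ
  have hD0 : 0 < D := by linarith
  have hℓ2 : (2 : ℝ) ≤ ℓ := by exact_mod_cast hℓ.1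
  rw [mul_add]
  gcongr ?_ + ?_
  · calc x ℓ ^ ((2 : ℝ) / ℓ) ≤ (D * f ℓ) ^ ((2 : ℝ) / ℓ) := by
          gcongr; exact h ℓ mℓ
      _ = D ^ ((2 : ℝ) / ℓ) * f ℓ ^ ((2 : ℝ) / ℓ) := Real.mul_rpow hD0.le hfℓ
      _ ≤ D ^ (1 : ℝ) * f ℓ ^ ((2 : ℝ) / ℓ) := by
          gcongr
          rw [div_le_one (by linarith)]; exact hℓ2
      _ = D * f ℓ ^ ((2 : ℝ) / ℓ) := by rw [Real.rpow_one]
  · set a := (1 : ℝ) / ((ℓ : ℝ) - 1) with ha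
    have ha0 : 0 ≤ a := by rw [ha]; exact div_nonneg zero_le_one (by linarith)
    have ha1 : 0 ≤ 1 - a := by rw [sub_nonneg, ha, div_le_one (by linarith)]; linarith
    calc x ℓ ^ a * x 1 ^ (1 - a) ≤ (D * f ℓ) ^ a * (D * f 1) ^ (1 - a) := by
          gcongr
          exacts [h ℓ mℓ, h 1 m1]
      _ = (D ^ a * D ^ (1 - a)) * (f ℓ ^ a * f 1 ^ (1 - a)) := by
          rw [Real.mul_rpow hD0.le hfℓ, Real.mul_rpow hD0.le hf1]; ring
      _ = D * (f ℓ ^ a * f 1 ^ (1 - a)) := by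
          rw [← Real.rpow_add hD0, add_sub_cancel, Real.rpow_one]

/-- With one colour, the activity probability `q` must be at least `x_ℓ ^ (1 / ℓ)` for all `ℓ`; this
leads to the terms `x_ℓ ^ (2 / ℓ)`. If `x_1` is the largest of these, `q = x_1` still allows `N`
colours with `N ^ (ℓ - 1) ≤ q ^ ℓ / x_ℓ` for all `ℓ`, which leads to the mixed terms. -/
theorem exists_parameters {s : ℕ} (hs : 2 ≤ s) {x : ℕ → ℝ} (hx : ∀ ℓ ∈ Finset.Icc 1 s, 0 ≤ x ℓ)
    (hxs : 0 < x s) :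
    ∃ N : ℕ, 0 < N ∧ ∃ q : ℝ, 0 < q ∧ q ≤ 1 ∧
      (∀ ℓ ∈ Finset.Icc 1 s, x ℓ * ((N : ℝ) ^ (ℓ - 1) / q ^ ℓ - 1) ≤ 1) ∧
      q ^ 2 / N ≤ 2 * rateSum s x := by
  have h0 := rateSum_nonneg hx
  have hsub : ∀ ℓ ∈ Finset.Icc 2 s, ℓ ∈ Finset.Icc 1 s := fun ℓ hℓ => by
    rw [Finset.mem_Icc] at *; omega
  have hmemS : s ∈ Finset.Icc 2 s := Finset.mem_Icc.2 ⟨hs, le_rfl⟩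
  have hx1 := hx 1 (Finset.mem_Icc.2 ⟨le_rfl, by omega⟩)
  have hfirst : ∀ ℓ ∈ Finset.Icc 2 s, x ℓ ^ ((2 : ℝ) / ℓ) ≤ rateSum s x := fun ℓ hℓ =>
    le_trans (le_add_of_nonneg_right (by have := hx ℓ (hsub ℓ hℓ); positivity))
      (term_le_rateSum hx hℓ)
  have hsecond : ∀ ℓ ∈ Finset.Icc 2 s,
      x ℓ ^ ((1 : ℝ) / ((ℓ : ℝ) - 1)) * x 1 ^ (1 - (1 : ℝ) / ((ℓ : ℝ) - 1)) ≤ rateSum s x :=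
    fun ℓ hℓ => le_trans (le_add_of_nonneg_left (by have := hx ℓ (hsub ℓ hℓ); positivity))
      (term_le_rateSum hx hℓ)
  by_cases hbig : ∃ j ∈ Finset.Icc 2 s, 1 ≤ x j
  · -- The bound is trivial, and everything is sampled.
    obtain ⟨j, hj, hxj⟩ := hbig
    refine ⟨1, one_pos, 1, one_pos, le_rfl, fun ℓ _ => by simp, ?_⟩
    have := Real.one_le_rpow hxj (by positivity : (0 : ℝ) ≤ 2 / j)
    norm_num
    linarith [hfirst j hj]
  push Not at hbig
  obtain ⟨j, hj, hjmax⟩ := Finset.exists_max_image (Finset.Icc 2 s)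
    (fun ℓ : ℕ => x ℓ ^ ((1 : ℝ) / ℓ)) ⟨s, hmemS⟩
  set y := x j ^ ((1 : ℝ) / j) with hy
  have hypos : 0 < y := lt_of_lt_of_le (by positivity) (hjmax s hmemS)
  have hxy : ∀ ℓ ∈ Finset.Icc 2 s, x ℓ ≤ y ^ ℓ := fun ℓ hℓ => by
    have hℓ0 : ℓ ≠ 0 := by rw [Finset.mem_Icc] at hℓ; omega
    calc x ℓ = (x ℓ ^ ((1 : ℝ) / ℓ)) ^ ℓ := by
          rw [one_div, Real.rpow_inv_natCast_pow (hx ℓ (hsub ℓ hℓ)) hℓ0]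
      _ ≤ y ^ ℓ := by
          have := hx ℓ (hsub ℓ hℓ)
          gcongr
          exact hjmax ℓ hℓ
  have hj2 := (Finset.mem_Icc.1 hj).1
  have hy1 : y < 1 := Real.rpow_lt_one (hx j (hsub j hj)) (hbig j hj)
    (by have : (0 : ℝ) < j := by exact_mod_cast (by omega : 0 < j)
        positivity)
  -- The activity probability is `max y (min 1 (x 1))`.
  rcases le_or_gt (min 1 (x 1)) y with hcase | hcase
  · have hx1y : x 1 ≤ y := by
      rcases min_le_iff.1 hcase with h | h
      · exact absurd h (not_le.2 hy1)
      · exact h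
    refine ⟨1, one_pos, y, hypos, hy1.le, fun ℓ hℓ => ?_, ?_⟩
    · have hle : x ℓ ≤ y ^ ℓ := by
        rcases (Finset.mem_Icc.1 hℓ).1.eq_or_lt with h | h
        · rw [← h, pow_one]; exact hx1y
        · exact hxy ℓ (Finset.mem_Icc.2 ⟨h, (Finset.mem_Icc.1 hℓ).2⟩)
      have hdiv := (div_le_one (by positivity : 0 < y ^ ℓ)).2 hle
      have heq : x ℓ * (((1 : ℕ) : ℝ) ^ (ℓ - 1) / y ^ ℓ - 1) = x ℓ / y ^ ℓ - x ℓ := by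
        rw [Nat.cast_one, one_pow]; ring
      rw [heq]
      linarith [hx ℓ hℓ]
    · have hsq : y ^ 2 = x j ^ ((2 : ℝ) / j) := by
        rw [hy, ← Real.rpow_natCast, ← Real.rpow_mul (hx j (hsub j hj))]
        congr 1
        push_cast
        ring
      rw [Nat.cast_one, div_one, hsq]
      linarith [hfirst j hj]
  · set q := min 1 (x 1) with hq
    have hqpos : 0 < q := hypos.trans hcase
    have hq1 : q ≤ 1 := min_le_left _ _
    have hqx : q ≤ x 1 := min_le_right _ _
    obtain ⟨i, hi, himax⟩ := Finset.exists_max_image (Finset.Icc 2 s)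
      (fun ℓ : ℕ => (x ℓ / q ^ ℓ) ^ ((1 : ℝ) / ((ℓ : ℝ) - 1))) ⟨s, hmemS⟩
    set t := (x i / q ^ i) ^ ((1 : ℝ) / ((i : ℝ) - 1)) with ht
    have htpos : 0 < t := lt_of_lt_of_le (by positivity) (himax s hmemS)
    have hxi := hx i (hsub i hi)
    have hi2 : (2 : ℝ) ≤ i := by exact_mod_cast (Finset.mem_Icc.1 hi).1
    have ht1 : t ≤ 1 := by
      refine Real.rpow_le_one (by positivity) ?_ (div_nonneg zero_le_one (by linarith))
      rw [div_le_one (by positivity)]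
      exact (hxy i hi).trans (by gcongr)
    have hinv : 1 ≤ 1 / t := by rwa [one_le_div htpos]
    have hNpos : 0 < ⌊1 / t⌋₊ := Nat.floor_pos.2 hinv
    have hNle : (⌊1 / t⌋₊ : ℝ) ≤ 1 / t := Nat.floor_le (by positivity)
    have hNge : 1 / t ≤ 2 * ⌊1 / t⌋₊ := by
      have h1 := Nat.lt_floor_add_one (1 / t)
      have h2 : (1 : ℝ) ≤ ⌊1 / t⌋₊ := by exact_mod_cast hNpos
      linarith
    -- The condition on `N` is that `N ≤ 1 / t`.
    set N := ⌊1 / t⌋₊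
    have hN0 : (0 : ℝ) < N := by exact_mod_cast hNpos
    refine ⟨N, hNpos, q, hqpos, hq1, fun ℓ hℓ => ?_, ?_⟩
    · rcases (Finset.mem_Icc.1 hℓ).1.eq_or_lt with h | h
      · rw [← h, Nat.sub_self, pow_zero, pow_one]
        rcases min_choice 1 (x 1) with h1 | h1
        · rw [hq, h1]; simp
        · have hqe : q = x 1 := h1
          have hx1pos : 0 < x 1 := hqe ▸ hqpos
          rw [hqe, mul_sub, mul_one_div_cancel hx1pos.ne']
          linarith
      · have hℓ' : ℓ ∈ Finset.Icc 2 s := Finset.mem_Icc.2 ⟨h, (Finset.mem_Icc.1 hℓ).2⟩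
        have hxℓ := hx ℓ hℓ
        have hroot : x ℓ / q ^ ℓ ≤ t ^ (ℓ - 1) := by
          have hcast : (ℓ : ℝ) - 1 = ((ℓ - 1 : ℕ) : ℝ) := by
            rw [Nat.cast_sub (by omega), Nat.cast_one]
          calc x ℓ / q ^ ℓ = ((x ℓ / q ^ ℓ) ^ ((1 : ℝ) / ((ℓ : ℝ) - 1))) ^ (ℓ - 1) := by
                rw [hcast, one_div, Real.rpow_inv_natCast_pow (by positivity) (by omega)]
            _ ≤ t ^ (ℓ - 1) := by
                gcongr
                exact himax ℓ hℓ'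
        calc x ℓ * ((N : ℝ) ^ (ℓ - 1) / q ^ ℓ - 1) = x ℓ / q ^ ℓ * (N : ℝ) ^ (ℓ - 1) - x ℓ := by
              ring
          _ ≤ t ^ (ℓ - 1) * (1 / t) ^ (ℓ - 1) - 0 := by gcongr
          _ = 1 := by
              rw [← mul_pow, mul_one_div_cancel htpos.ne', one_pow, sub_zero]
    · have hrate : q ^ 2 * t ≤ rateSum s x := by
        refine le_trans (le_of_eq_of_le (b := x i ^ ((1 : ℝ) / ((i : ℝ) - 1)) *
          q ^ (1 - (1 : ℝ) / ((i : ℝ) - 1))) ?_ ?_) (hsecond i hi)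
        · rw [ht, Real.div_rpow hxi (by positivity), ← Real.rpow_natCast q i,
            ← Real.rpow_mul hqpos.le, mul_div_assoc', mul_comm (q ^ 2), mul_div_assoc,
            ← Real.rpow_natCast q 2, ← Real.rpow_sub hqpos]
          congr 2
          have : (i : ℝ) - 1 ≠ 0 := by linarith
          push_cast
          field_simp
          ring
        · have : 0 ≤ 1 - (1 : ℝ) / ((i : ℝ) - 1) := by
            rw [sub_nonneg, div_le_one (by linarith)]; linarith
          gcongr
      rw [div_le_iff₀ hN0]
      have h1 : 1 ≤ 2 * N * t := (div_le_iff₀ htpos).1 hNge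
      nlinarith [sq_nonneg q]

end SubgraphSampling

open SubgraphSampling in
theorem mainTheorem3 (s : ℕ) (K : ℝ) (hK : 1 ≤ K) :
    ∃ C : ℝ, 0 < C ∧
      ∀ (A : SimpleGraph (Fin s)) (V : Type u) [Fintype V] (ε δ : ℝ),
        0 < ε → 0 < δ → δ < 1 →
        ∀ (M' : ℝ) (f' : ℕ → ℝ),
          ∃ alg : SamplingAlgorithm V,
            ∀ G : SimpleGraph V,
              2 ≤ G.copyCount A →
              WithinFactor K M' (G.copyCount A : ℝ) →
              (∀ ℓ ∈ Finset.Icc 1 s, WithinFactor K (f' ℓ) (pairFraction G A ℓ)) →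
              1 - δ ≤ alg.successProb G ε (G.copyCount A : ℝ) ∧
              alg.expectedSamples G ≤
                C * ((G.edgeSet.ncard : ℝ) * (Real.log (1 / δ) / ε ^ 2) *
                  Real.log (G.copyCount A : ℝ) * rateSum s (pairFraction G A)) := by
  have hlog2 : 0 < Real.log 2 := Real.log_pos one_lt_two
  have hK0 : 0 < K := by linarith
  refine ⟨64 * (s + 1) * K ^ 2 / Real.log 2 ^ 2, by positivity, ?_⟩
  intro A V _ ε δ hε hδ hδ1 M' f'
  have hlogδ : 0 ≤ Real.log (1 / δ) := Real.log_nonneg (by rw [le_div_iff₀ hδ]; linarith)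
  have hbound_nonneg : ∀ G : SimpleGraph V, 0 ≤ 64 * (s + 1) * K ^ 2 / Real.log 2 ^ 2 *
      ((G.edgeSet.ncard : ℝ) * (Real.log (1 / δ) / ε ^ 2) *
        Real.log (G.copyCount A : ℝ) * rateSum s (pairFraction G A)) := fun G => by
    have h1 := rateSum_nonneg (s := s) fun ℓ _ => pairFraction_nonneg G A ℓ
    have h2 := Real.log_natCast_nonneg (G.copyCount A)
    positivity
  -- An algorithm without samples is enough if its constant output is always correct.
  have hconst : ∀ c : ℝ, (∀ G : SimpleGraph V, |c - G.copyCount A| ≤ ε * G.copyCount A) →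
      ∀ G : SimpleGraph V, 1 - δ ≤ (SamplingAlgorithm.const V c).successProb G ε (G.copyCount A) ∧
        (SamplingAlgorithm.const V c).expectedSamples G ≤ 64 * (s + 1) * K ^ 2 / Real.log 2 ^ 2 *
      ((G.edgeSet.ncard : ℝ) * (Real.log (1 / δ) / ε ^ 2) *
        Real.log (G.copyCount A : ℝ) * rateSum s (pairFraction G A)) := fun c hc G => by
    refine ⟨?_, ?_⟩
    · rw [SamplingAlgorithm.successProb_const (hc G)]; linarith
    · rw [SamplingAlgorithm.expectedSamples_const]; exact hbound_nonneg G
  rcases le_or_gt 1 ε with hε1 | hε1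
  · refine ⟨_, fun G _ _ _ => hconst 0 (fun G => ?_) G⟩
    rw [zero_sub, abs_neg, Nat.abs_cast]
    exact le_mul_of_one_le_left (Nat.cast_nonneg _) hε1
  rcases le_or_gt s 1 with hs | hs
  · refine ⟨_, fun G _ _ _ => hconst ((⊥ : SimpleGraph V).copyCount A) (fun G => ?_) G⟩
    rw [copyCount_eq_copyCount_bot hs G A, sub_self, abs_zero]
    positivity
  have hs' : (0 : ℝ) < s := by exact_mod_cast (by omega : 0 < s)
  -- Unless some graph fits the given data, nothing has to be shown.
  by_cases hex : ∃ G : SimpleGraph V, 2 ≤ G.copyCount A ∧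
      ∀ ℓ ∈ Finset.Icc 1 s, WithinFactor K (f' ℓ) (pairFraction G A ℓ)
  swap
  · exact ⟨SamplingAlgorithm.const V 0, fun G hG _ hf => absurd ⟨G, hG, hf⟩ hex⟩
  obtain ⟨G₀, hG₀, hf₀⟩ := hex
  let x : ℕ → ℝ := fun ℓ => 16 * s * K / ε ^ 2 * f' ℓ
  have hx : ∀ ℓ ∈ Finset.Icc 1 s, 0 ≤ x ℓ := fun ℓ hℓ => by
    have := (div_nonneg (pairFraction_nonneg G₀ A ℓ) hK0.le).trans (hf₀ ℓ hℓ).1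
    positivity
  have hxs : 0 < x s := by
    have := (div_pos (pairFraction_self_pos G₀ A (by omega)) hK0).trans_le
      (hf₀ s (Finset.mem_Icc.2 ⟨by omega, le_rfl⟩)).1
    positivity
  obtain ⟨N, hN, q, hq, hq1, hvar, hrate⟩ := exists_parameters hs hx hxs
  have hN1 : (1 : ℝ) ≤ N := by exact_mod_cast hN
  obtain ⟨base, hfin, hdisc, hedge, hbase⟩ :=
    exists_monochromatic_sampling V (by omega : 0 < s) A hN hq hq1
  obtain ⟨alg, hedge', hsuccess⟩ := base.exists_amplification hδ hδ1
  refine ⟨alg, fun G hG _ hf => ⟨hsuccess G ε _ (hbase G ε hε (by omega) ?_), ?_⟩⟩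
  · have hterm : ∀ ℓ ∈ Finset.Icc 1 s,
        pairFraction G A ℓ * ((N : ℝ) ^ (ℓ - 1) / q ^ ℓ - 1) ≤ ε ^ 2 / (16 * s) := fun ℓ hℓ => by
      have hfx : pairFraction G A ℓ ≤ ε ^ 2 / (16 * s) * x ℓ := by
        have h := (div_le_iff₀ hK0).1 (hf ℓ hℓ).1
        refine h.trans (le_of_eq ?_)
        simp only [x]
        field_simp
      have hexcess : 0 ≤ (N : ℝ) ^ (ℓ - 1) / q ^ ℓ - 1 := by
        rw [sub_nonneg, one_le_div (by positivity)]
        exact (pow_le_one₀ hq.le hq1).trans (one_le_pow₀ hN1)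
      calc _ ≤ ε ^ 2 / (16 * s) * x ℓ * ((N : ℝ) ^ (ℓ - 1) / q ^ ℓ - 1) := by gcongr
        _ = ε ^ 2 / (16 * s) * (x ℓ * ((N : ℝ) ^ (ℓ - 1) / q ^ ℓ - 1)) := mul_assoc _ _ _
        _ ≤ ε ^ 2 / (16 * s) * 1 := by
            gcongr
            exact hvar ℓ hℓ
        _ = ε ^ 2 / (16 * s) := mul_one _
    refine (Finset.sum_le_card_nsmul _ _ _ hterm).trans (le_of_eq ?_)
    rw [Nat.card_Icc, nsmul_eq_mul, Nat.add_sub_cancel]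
    field_simp
  · set R := rateSum s (pairFraction G A) with hR
    have hR0 : 0 ≤ R := rateSum_nonneg fun ℓ _ => pairFraction_nonneg G A ℓ
    have hD : 1 ≤ 16 * s * K ^ 2 / ε ^ 2 := by
      have h1 : (1 : ℝ) ≤ s := by exact_mod_cast hs.le
      have h2 : 1 ≤ K ^ 2 := one_le_pow₀ hK
      have h3 : ε ^ 2 ≤ 1 := pow_le_one₀ hε.le hε1.le
      rw [one_le_div (by positivity)]
      nlinarith
    have hxR : rateSum s x ≤ 16 * s * K ^ 2 / ε ^ 2 * R := by
      refine rateSum_le_mul_rateSum hD hx (fun ℓ _ => pairFraction_nonneg G A ℓ) fun ℓ hℓ => ?_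
      calc x ℓ ≤ 16 * s * K / ε ^ 2 * (K * pairFraction G A ℓ) := by
            simp only [x]
            gcongr
            exact (hf ℓ hℓ).2
        _ = _ := by ring
    have hlogM : Real.log 2 ≤ Real.log (G.copyCount A) :=
      Real.log_le_log two_pos (by exact_mod_cast hG)
    have hP : ∀ u v : V, u ≠ v → alg.μ.real {r | s(u, v) ∈ alg.sample r} ≤
        2 / Real.log 2 * Real.log (1 / δ) * (2 * (16 * s * K ^ 2 / ε ^ 2 * R)) := fun u v huv => by
      refine (hedge' _).trans ?_
      rw [hedge u v huv]
      gcongr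
      linarith
    calc alg.expectedSamples G ≤ G.edgeSet.ncard *
          (2 / Real.log 2 * Real.log (1 / δ) * (2 * (16 * s * K ^ 2 / ε ^ 2 * R))) :=
          alg.expectedSamples_le hP G
      _ = 64 * s * K ^ 2 / Real.log 2 ^ 2 * (G.edgeSet.ncard * (Real.log (1 / δ) / ε ^ 2) *
          Real.log 2 * R) := by field_simp; ring
      _ ≤ _ := by
          gcongr
          linarith
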